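/- All graphs are finite undirected graphs $G=(V,E)$, with loops and parallel edges allowed, and have no isolated vertices (every vertex is incident to an edge, possibly a loop). A graph is connected if it has a vertex and any two of its vertices are joined by a path (so a one-vertex graph is connected); the components of $G$ are its maximal connected subgraphs. A leaf is a vertex incident to exactly one edge, this edge not being a loop. A cycle is a subgraph-minimal graph among the nonempty graphs in which every vertex has degree $2$, a loop counting twice (thus a single loop and a pair of parallel edges are cycles). A graph is a cacti-graph if it has no isolated vertices, no leaves, and no component that is a cycle; it need not be connected. For $Y\subseteq E(G)$ let $G\langle Y\rangle$ be the subgraph of $G$ whose edges are those in $Y$ and whose vertices are the ends of the edges in $Y$. For an integer $k\ge 0$, the $k$-circular matroid $M_k(G)$ is the matroid on $E(G)$ whose circuits are the inclusion-minimal nonempty sets $C\subseteq E(G)$ with $|C|=|V(G\langle C\rangle)|+k$. A matroid on a finite set $E$ is non-trivial if $E$ is neither a base of it nor a base of its dual, and connected if $|E|\ge 2$ and for all $a,b\in E$ some circuit contains both $a$ and $b$. Theorem. Let $G$ be a finite graph without isolated vertices. (i) For every integer $k\ge 2$, the following are equivalent: (a1) $M_k(G)$ is non-trivial and $G$ is a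 cacti-graph (connected or not); (a2) $M_k(G)$ is a connected matroid. (ii) The following are equivalent: (a1) $M_1(G)$ is non-trivial and $G$ is a connected cacti-graph; (a2) $M_1(G)$ is a connected matroid. -/

import Mathlib

namespace Graph

/-- The degree of a vertex: the number of non-loop edges at `v` plus twice the number of loops
at `v` (used for finite graphs only). -/
noncomputable def deg {α β : Type*} (G : Graph α β) (v : α) : ℕ :=
  {e | G.IsNonloopAt e v}.ncard + 2 * {e | G.IsLoopAt e v}.ncard

/-- No vertex is isolated: every vertex is incident to some edge (possibly only to loops). -/
def NoIsolatedVertices {α β : Type*} (G : Graph α β) : Prop :=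
  ∀ v ∈ G.vertexSet, ∃ e, G.Inc e v

/-- A leaf is a vertex that is incident to exactly one edge, this edge not being a loop. -/
def IsLeaf {α β : Type*} (G : Graph α β) (v : α) : Prop :=
  ∃ e, G.incidenceSet v = {e} ∧ G.IsNonloopAt e v

/-- A graph is connected if it has a vertex and any two of its vertices are joined by a walk.
One-vertex graphs are connected. -/
def IsConnected {α β : Type*} (G : Graph α β) : Prop :=
  G.vertexSet.Nonempty ∧
    ∀ x ∈ G.vertexSet, ∀ y ∈ G.vertexSet, Relation.ReflTransGen G.Adj x y

/-- The components of `G` are its maximal connected subgraphs. -/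
def IsComponent {α β : Type*} (A G : Graph α β) : Prop :=
  Maximal (fun H : Graph α β => H ≤ G ∧ H.IsConnected) A

/-- A cycle is a subgraph-minimal graph among the (nonempty) graphs all of whose vertices have
degree two. A loop at a single vertex and a pair of parallel edges are cycles. -/
def IsCycleGraph {α β : Type*} (C : Graph α β) : Prop :=
  Minimal (fun H : Graph α β => H.vertexSet.Nonempty ∧ ∀ v ∈ H.vertexSet, H.deg v = 2) C

/-- A cacti-graph is a graph without isolated vertices, without leaves and without components
that are cycles. It need not be connected. -/
structure IsCactiGraph {α β : Type*} (G : Graph α β) : Prop where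
  no_isolated : G.NoIsolatedVertices
  no_leaf : ∀ v ∈ G.vertexSet, ¬ G.IsLeaf v
  no_cycle_component : ∀ A : Graph α β, A.IsComponent G → ¬ A.IsCycleGraph

/-- The subgraph `G⟨Y⟩` of `G` induced by a set `Y` of edges: its edges are the edges of `G` in
`Y`, and its vertices are the ends of these edges. -/
def edgeInduce {α β : Type*} (G : Graph α β) (Y : Set β) : Graph α β where
  vertexSet := {x | ∃ e ∈ Y, G.Inc e x}
  IsLink e x y := e ∈ Y ∧ G.IsLink e x y
  isLink_symm _ _ := ⟨fun _ _ h => ⟨h.1, h.2.symm⟩⟩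
  eq_or_eq_of_isLink_of_isLink _ _ _ _ _ h h' := h.2.left_eq_or_eq h'.2
  left_mem_of_isLink e _ y h := ⟨e, h.1, y, h.2⟩

/-- The family `C_k(G)` of inclusion-minimal nonempty edge sets `C` with
`|C| = |V(G⟨C⟩)| + k`. -/
def IsKCircuit {α β : Type*} (G : Graph α β) (k : ℕ) (C : Set β) : Prop :=
  Minimal (fun X : Set β => X ⊆ G.edgeSet ∧ X.Nonempty ∧
    X.ncard = (G.edgeInduce X).vertexSet.ncard + k) C

/-- An edge set is `k`-independent if it contains no member of `C_k(G)`. -/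
def KIndep {α β : Type*} (G : Graph α β) (k : ℕ) (I : Set β) : Prop :=
  I ⊆ G.edgeSet ∧ ∀ C, G.IsKCircuit k C → ¬ C ⊆ I

section Helpers

variable {α β : Type*} {G : Graph α β} {k : ℕ}

theorem finite_edgeInduce_vertexSet {X : Set β} (hX : X.Finite) :
    (G.edgeInduce X).vertexSet.Finite := by
  have h : (G.edgeInduce X).vertexSet = ⋃ e ∈ X, {x | G.Inc e x} := by
    ext x; simp [edgeInduce]
  rw [h]
  refine hX.biUnion fun e _ => ?_
  by_cases he : e ∈ G.edgeSet
  · obtain ⟨x, y, hxy⟩ := G.exists_isLink_of_mem_edgeSet he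
    exact (Set.toFinite {x, y}).subset fun z hz => by
      simpa using Graph.Inc.eq_or_eq_of_isLink hz hxy
  · convert Set.finite_empty (α := α) using 1
    ext x; simp [he]

theorem edgeInduce_vertexSet_mono {X Y : Set β} (h : X ⊆ Y) :
    (G.edgeInduce X).vertexSet ⊆ (G.edgeInduce Y).vertexSet :=
  fun _ ⟨e, he, hx⟩ => ⟨e, h he, hx⟩

theorem edgeInduce_vertexSet_union (X Y : Set β) :
    (G.edgeInduce (X ∪ Y)).vertexSet =
      (G.edgeInduce X).vertexSet ∪ (G.edgeInduce Y).vertexSet := by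
  ext x
  simp only [edgeInduce, Set.mem_union, Set.mem_ofPred_eq]
  constructor
  · rintro ⟨e, he | he, hx⟩
    · exact Or.inl ⟨e, he, hx⟩
    · exact Or.inr ⟨e, he, hx⟩
  · rintro (⟨e, he, hx⟩ | ⟨e, he, hx⟩)
    · exact ⟨e, Or.inl he, hx⟩
    · exact ⟨e, Or.inr he, hx⟩

theorem exists_isKCircuit_subset (hE : G.edgeSet.Finite) {X : Set β} (hXE : X ⊆ G.edgeSet)
    (hX : X.Nonempty) (hc : (G.edgeInduce X).vertexSet.ncard + k ≤ X.ncard) :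
    ∃ C ⊆ X, G.IsKCircuit k C := by
  have key : ∀ n : ℕ, ∀ X : Set β, X ⊆ G.edgeSet → X.Nonempty → X.ncard = n →
      (G.edgeInduce X).vertexSet.ncard + k ≤ X.ncard →
      ∃ C ⊆ X, C ⊆ G.edgeSet ∧ C.Nonempty ∧
        C.ncard = (G.edgeInduce C).vertexSet.ncard + k := by
    intro n
    induction n with
    | zero =>
      intro X hXE hX hn _
      exact absurd hn ((Set.ncard_pos (hE.subset hXE)).2 hX).ne'
    | succ n ih =>
      intro X hXE hX hn hc
      by_cases heq : X.ncard = (G.edgeInduce X).vertexSet.ncard + k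
      · exact ⟨X, subset_rfl, hXE, hX, heq⟩
      obtain ⟨e, he⟩ := hX
      have hXf := hE.subset hXE
      have hcard : (X \ {e}).ncard + 1 = X.ncard := Set.ncard_sdiff_singleton_add_one he hXf
      obtain ⟨x, y, hxy⟩ := G.exists_isLink_of_mem_edgeSet (hXE he)
      have hpos : 0 < (G.edgeInduce X).vertexSet.ncard :=
        (Set.ncard_pos (finite_edgeInduce_vertexSet hXf)).2 ⟨x, e, he, hxy.inc_left⟩
      have hmono : (G.edgeInduce (X \ {e})).vertexSet.ncard ≤
          (G.edgeInduce X).vertexSet.ncard :=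
        Set.ncard_le_ncard (edgeInduce_vertexSet_mono Set.sdiff_subset)
          (finite_edgeInduce_vertexSet hXf)
      have hne : (X \ {e}).Nonempty := by
        rw [← Set.ncard_pos (hXf.subset Set.sdiff_subset)]
        omega
      obtain ⟨C, hCX, hC⟩ := ih (X \ {e}) (Set.sdiff_subset.trans hXE) hne (by omega) (by omega)
      exact ⟨C, hCX.trans Set.sdiff_subset, hC⟩
  obtain ⟨C, hCX, hC⟩ := key _ X hXE hX rfl hc
  have hfin : {Y : Set β | Y ⊆ C}.Finite := (hE.subset hC.1).finite_subsets
  have hfin' := hfin.subset (fun Y (hY : Y ∈ {Y : Set β | Y ⊆ C ∧ Y ⊆ G.edgeSet ∧ Y.Nonempty ∧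
      Y.ncard = (G.edgeInduce Y).vertexSet.ncard + k}) => hY.1)
  obtain ⟨D, hDC, hD⟩ := hfin'.exists_le_minimal ⟨subset_rfl, hC⟩
  refine ⟨D, hDC.trans hCX, hD.prop.2, fun Y hY hYD => ?_⟩
  exact hD.le_of_le ⟨hYD.trans hDC, hY⟩ hYD

/-- Circuit elimination for the family `C_k(G)`. -/
theorem IsKCircuit.elim (hE : G.edgeSet.Finite) {C D : Set β} (hC : G.IsKCircuit k C)
    (hD : G.IsKCircuit k D) (hne : C ≠ D) {e : β} (heC : e ∈ C) (heD : e ∈ D) :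
    ∃ F ⊆ (C ∪ D) \ {e}, G.IsKCircuit k F := by
  have hCf := hE.subset hC.prop.1
  have hDf := hE.subset hD.prop.1
  have hnsub : ¬ C ⊆ D := fun h => hne (h.antisymm (hD.le_of_le hC.prop h))
  obtain ⟨f, hfC, hfD⟩ := Set.not_subset.1 hnsub
  have hI : ¬ ((G.edgeInduce (C ∩ D)).vertexSet.ncard + k ≤ (C ∩ D).ncard) := by
    intro h
    obtain ⟨F, hF, hFc⟩ := exists_isKCircuit_subset hE (Set.inter_subset_left.trans hC.prop.1)
      ⟨e, heC, heD⟩ h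
    have : C ⊆ F := hC.le_of_le hFc.prop (hF.trans Set.inter_subset_left)
    exact hfD (hF (this hfC)).2
  have hVI : (G.edgeInduce (C ∩ D)).vertexSet.ncard ≤
      ((G.edgeInduce C).vertexSet ∩ (G.edgeInduce D).vertexSet).ncard :=
    Set.ncard_le_ncard (Set.subset_inter (edgeInduce_vertexSet_mono Set.inter_subset_left)
      (edgeInduce_vertexSet_mono Set.inter_subset_right))
      ((finite_edgeInduce_vertexSet hCf).inter_of_left _)
  have hV := Set.ncard_union_add_ncard_inter (G.edgeInduce C).vertexSet
    (G.edgeInduce D).vertexSet (finite_edgeInduce_vertexSet hCf) (finite_edgeInduce_vertexSet hDf)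
  have hU := Set.ncard_union_add_ncard_inter C D hCf hDf
  have hCc := hC.prop.2.2
  have hDc := hD.prop.2.2
  rw [← edgeInduce_vertexSet_union] at hV
  have hUf : (C ∪ D).Finite := hCf.union hDf
  have hcard : ((C ∪ D) \ {e}).ncard + 1 = (C ∪ D).ncard :=
    Set.ncard_sdiff_singleton_add_one (Or.inl heC) hUf
  have hmono : (G.edgeInduce ((C ∪ D) \ {e})).vertexSet.ncard ≤
      (G.edgeInduce (C ∪ D)).vertexSet.ncard :=
    Set.ncard_le_ncard (edgeInduce_vertexSet_mono Set.sdiff_subset)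
      (finite_edgeInduce_vertexSet hUf)
  refine exists_isKCircuit_subset hE
    (Set.sdiff_subset.trans (Set.union_subset hC.prop.1 hD.prop.1))
    ⟨f, Or.inl hfC, fun h => hfD (by rw [Set.mem_singleton_iff.1 h]; exact heD)⟩ (by omega)

theorem kIndep_augment (hE : G.edgeSet.Finite) {I J : Set β} (hI : G.KIndep k I)
    (hJ : G.KIndep k J) (hIJ : I.ncard < J.ncard) :
    ∃ e ∈ J, e ∉ I ∧ G.KIndep k (insert e I) := by
  by_contra! hcon
  have hIf := hE.subset hI.1
  have hJf := hE.subset hJ.1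
  -- choose a larger independent subset of the union that misses as little of `I` as possible
  let P : ℕ → Prop := fun n => ∃ K ⊆ I ∪ J, G.KIndep k K ∧ I.ncard < K.ncard ∧ (I \ K).ncard = n
  have hP : ∃ n, P n := ⟨_, J, Set.subset_union_right, hJ, hIJ, rfl⟩
  classical
  obtain ⟨K, hKU, hK, hIK, hKn⟩ := Nat.find_spec hP
  have hmin : ∀ K' ⊆ I ∪ J, G.KIndep k K' → I.ncard < K'.ncard →
      (I \ K).ncard ≤ (I \ K').ncard := fun K' h1 h2 h3 => by
    rw [hKn]; exact Nat.find_min' hP ⟨K', h1, h2, h3, rfl⟩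
  have hKf := hE.subset hK.1
  have hnot : ¬ I ⊆ K := by
    intro hsub
    obtain ⟨f, hfK, hfI⟩ := Set.exists_mem_notMem_of_ncard_lt_ncard hIK hIf
    have hfJ : f ∈ J := (hKU hfK).resolve_left hfI
    refine hcon f hfJ hfI ⟨Set.insert_subset (hJ.1 hfJ) hI.1, fun C hC hCs => ?_⟩
    exact hK.2 C hC (hCs.trans (Set.insert_subset hfK hsub))
  obtain ⟨e, heI, heK⟩ := Set.not_subset.1 hnot
  have hT : ∀ f ∈ K \ I, ∃ C, G.IsKCircuit k C ∧ C ⊆ insert e K ∧ f ∉ C ∧ e ∈ C := by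
    intro f hf
    have hsubU : insert e (K \ {f}) ⊆ I ∪ J :=
      Set.insert_subset (Or.inl heI) (Set.sdiff_subset.trans hKU)
    have heKf : e ∉ K \ {f} := fun h => heK h.1
    have hcard : (insert e (K \ {f})).ncard = K.ncard := by
      rw [Set.ncard_insert_of_notMem heKf (hKf.subset Set.sdiff_subset)]
      exact Set.ncard_sdiff_singleton_add_one hf.1 hKf
    have hlt : (I \ insert e (K \ {f})).ncard < (I \ K).ncard := by
      refine Set.ncard_lt_ncard ⟨fun x hx => ⟨hx.1, fun hxK => hx.2 (Or.inr ⟨hxK, ?_⟩)⟩, ?_⟩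
        (hIf.subset Set.sdiff_subset)
      · intro hxf
        exact hf.2 (Set.mem_singleton_iff.1 hxf ▸ hx.1)
      · intro h
        exact (h ⟨heI, heK⟩).2 (Set.mem_insert _ _)
    have hdep : ¬ G.KIndep k (insert e (K \ {f})) := fun h => by
      have := hmin _ hsubU h (by omega)
      omega
    have hg : insert e (K \ {f}) ⊆ G.edgeSet := hsubU.trans (Set.union_subset hI.1 hJ.1)
    obtain ⟨C, hC, hCs⟩ : ∃ C, G.IsKCircuit k C ∧ C ⊆ insert e (K \ {f}) := by
      by_contra! h
      exact hdep ⟨hg, h⟩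
    refine ⟨C, hC, hCs.trans (Set.insert_subset_insert Set.sdiff_subset), fun hfC => ?_, ?_⟩
    · rcases hCs hfC with h | h
      · exact hf.2 (h ▸ heI)
      · exact h.2 rfl
    · by_contra heC
      exact hK.2 C hC fun x hx => ((hCs hx).resolve_left fun h => heC (h ▸ hx)).1
  obtain ⟨f, hfK, hfI⟩ := Set.exists_mem_notMem_of_ncard_lt_ncard hIK hIf
  obtain ⟨C, hC, hCs, -, heC⟩ := hT f ⟨hfK, hfI⟩
  have hCI : ¬ C ⊆ I := hI.2 C hC
  obtain ⟨g, hgC, hgI⟩ := Set.not_subset.1 hCI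
  have hgK : g ∈ K := (hCs hgC).resolve_left fun h => hgI (h ▸ heI)
  obtain ⟨D, hD, hDs, hgD, heD⟩ := hT g ⟨hgK, hgI⟩
  obtain ⟨F, hF, hFc⟩ := hC.elim hE hD (fun h => hgD (h ▸ hgC)) heC heD
  refine hK.2 F hFc fun x hx => ?_
  obtain ⟨hx1, hx2⟩ := hF hx
  rcases hx1 with h | h
  · exact (hCs h).resolve_left hx2
  · exact (hDs h).resolve_left hx2

end Helpers

/-- The `k`-circular matroid `M_k(G)` of a graph `G` with finitely many edges: the matroid on
the edge set of `G` whose circuits are the members of `C_k(G)`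
(see `kCircularMatroid_isCircuit_iff`). -/
noncomputable def kCircularMatroid {α β : Type*} (G : Graph α β) (hE : G.edgeSet.Finite)
    (k : ℕ) : Matroid β :=
  (IndepMatroid.ofFinite hE (G.KIndep k)
    ⟨Set.empty_subset _, fun _ hC hC0 => hC.prop.2.1.ne_empty (Set.subset_empty_iff.1 hC0)⟩
    (fun _ _ hJ hIJ => ⟨hIJ.trans hJ.1, fun C hC hCI => hJ.2 C hC (hCI.trans hIJ)⟩)
    (fun _ _ hI hJ hIJ => kIndep_augment hE hI hJ hIJ)
    (fun _ hI => hI.1)).matroid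

theorem kCircularMatroid_ground {α β : Type*} (G : Graph α β) (hE : G.edgeSet.Finite) (k : ℕ) :
    (G.kCircularMatroid hE k).E = G.edgeSet := rfl

theorem kCircularMatroid_isCircuit_iff {α β : Type*} (G : Graph α β) (hE : G.edgeSet.Finite)
    (k : ℕ) (C : Set β) : (G.kCircularMatroid hE k).IsCircuit C ↔ G.IsKCircuit k C := by
  have hdep : ∀ X, (G.kCircularMatroid hE k).Dep X ↔
      X ⊆ G.edgeSet ∧ ∃ D ⊆ X, G.IsKCircuit k D := by
    intro X
    have hi : (G.kCircularMatroid hE k).Indep X ↔ G.KIndep k X := Iff.rfl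
    rw [Matroid.Dep, hi, kCircularMatroid_ground, KIndep]
    constructor
    · rintro ⟨h1, h2⟩
      refine ⟨h2, ?_⟩
      by_contra! h
      exact h1 ⟨h2, fun D hD hDX => h D hDX hD⟩
    · rintro ⟨h2, D, hDX, hD⟩
      exact ⟨fun h => h.2 D hD hDX, h2⟩
  constructor
  · intro h
    obtain ⟨h1, D, hDC, hD⟩ := (hdep C).1 h.dep
    have : D = C := h.eq_of_dep_subset ((hdep D).2 ⟨hD.prop.1, D, subset_rfl, hD⟩) hDC
    exact this ▸ hD
  · intro h
    refine ⟨(hdep C).2 ⟨h.prop.1, C, subset_rfl, h⟩, fun X hX hXC => ?_⟩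
    obtain ⟨-, D, hDX, hD⟩ := (hdep X).1 hX
    exact (h.le_of_le hD.prop (hDX.trans hXC)).trans hDX

end Graph

namespace Matroid

/-- A matroid is non-trivial if its ground set is neither a base nor a cobase. -/
def IsNontrivial {β : Type*} (M : Matroid β) : Prop :=
  ¬ M.IsBase M.E ∧ ¬ M✶.IsBase M.E

/-- A matroid is connected if it has at least two elements and any two of its elements lie in
a common circuit. -/
def IsConnected {β : Type*} (M : Matroid β) : Prop :=
  2 ≤ M.E.encard ∧ ∀ a ∈ M.E, ∀ b ∈ M.E, ∃ C, M.IsCircuit C ∧ a ∈ C ∧ b ∈ C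

end Matroid

/-!
Write `d(X) = |X| - |V(G⟨X⟩)|` for the excess of an edge set `X`. The function `d` is
supermodular, hence so is the nullity `ν(X)`, the largest excess of a subset of `X`, and `ν` is
the nullity function of the bicircular matroid `M_1(G)`. Call `X` excess-strict if all its proper
subsets have smaller excess; equivalently, `M_1(G)` restricted to `X` has no coloops. For `k ≥ 1`
the circuits of `M_k(G)` are the excess-strict sets of excess `k`
(`Graph.isKCircuit_iff_isExcessStrict`).

The cacti-graphs are the graphs without isolated vertices whose edge set `E` is excess-strict. In
one direction (`Graph.IsCactiGraph.isExcessStrict`) this is a count of degrees outside a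
hypothetical proper subset of `E` of no smaller excess. In the other
(`Graph.isCactiGraph_of_forall_mem_isExcessStrict`), the edge at a leaf, or the edges of a cycle
component, can be deleted from any edge set without lowering its excess, so they lie in no circuit
of `M_k(G)`.

From an excess-strict set of excess greater than `|S|` one can pass to an excess-strict subset
that still contains `S` and has excess smaller by one
(`Graph.IsExcessStrict.exists_subset_excess_eq_sub_one`). Taking for `S` a pair of edges and
descending from `E`, whose excess is at least `k` when `M_k(G)` has a circuit, gives a circuit of
`M_k(G)` through the pair for every `k ≥ 2`.

For `k = 1` the descent keeps only one prescribed edge, and connectedness of `G` enters. If the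
edges `a` and `b` are in no common circuit, let `A` be the set of edges that share a circuit with
`a`. Sharing a circuit is a transitive relation, so every circuit lies in `A` or in `E \ A`, and
`d(E) = ν(E) ≤ ν(A) + ν(E \ A) = d(A) + d(E \ A)`. As `d(E) - d(A) - d(E \ A)` is the number of
vertices common to `A` and `E \ A`, there are none, and `G` is disconnected
(`Graph.exists_isKCircuit_one_mem_mem`). Conversely no circuit of `M_1(G)` meets two components
of `G`, because one of its parts would itself have positive excess.
-/

/-! ### Transitivity of sharing a circuit -/

namespace Matroid

/-- Lying in a common circuit is a transitive relation. Among the pairs of intersecting circuits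
through `x` and `z` one with smallest union is chosen; if no circuit contained both elements,
strong elimination at a common element would give a pair with a smaller union. -/
theorem exists_isCircuit_mem_mem_trans {β : Type*} {M : Matroid β} (hM : M.E.Finite)
    {x y z : β} {C₁ C₂ : Set β} (hC₁ : M.IsCircuit C₁) (hx₁ : x ∈ C₁) (hy₁ : y ∈ C₁)
    (hC₂ : M.IsCircuit C₂) (hy₂ : y ∈ C₂) (hz₂ : z ∈ C₂) :
    ∃ C, M.IsCircuit C ∧ x ∈ C ∧ z ∈ C := by
  by_contra! hcon
  let P : ℕ → Prop := fun n => ∃ C D, M.IsCircuit C ∧ M.IsCircuit D ∧ x ∈ C ∧ z ∈ D ∧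
    (C ∩ D).Nonempty ∧ (C ∪ D).ncard = n
  have hP : ∃ n, P n := ⟨_, C₁, C₂, hC₁, hC₂, hx₁, hz₂, ⟨y, hy₁, hy₂⟩, rfl⟩
  classical
  obtain ⟨C, D, hC, hD, hxC, hzD, ⟨e, heC, heD⟩, hn⟩ := Nat.find_spec hP
  have hUf : (C ∪ D).Finite := hM.subset (Set.union_subset hC.subset_ground hD.subset_ground)
  have hmin : ∀ C' D', M.IsCircuit C' → M.IsCircuit D' → x ∈ C' → z ∈ D' →
      (C' ∩ D').Nonempty → C' ∪ D' ⊆ C ∪ D → C' ∪ D' = C ∪ D := by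
    intro C' D' h1 h2 h3 h4 h5 hsub
    refine Set.eq_of_subset_of_ncard_le hsub ?_ hUf
    rw [hn]
    exact Nat.find_min' hP ⟨C', D', h1, h2, h3, h4, h5, rfl⟩
  have hxD : x ∉ D := fun h => hcon D hD h hzD
  have hzC : z ∉ C := fun h => hcon C hC hxC h
  obtain ⟨F, hFs, hF, hxF⟩ := hC.strong_elimination hD heC heD hxC hxD
  obtain ⟨F', hFs', hF', hzF'⟩ := hD.strong_elimination hC heD heC hzD hzC
  have hFD : (F ∩ D).Nonempty := by
    by_contra h
    have hsub : F ⊆ C := fun w hw => (hFs hw).1.resolve_right fun hwD => h ⟨w, hw, hwD⟩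
    have := hF.eq_of_subset_isCircuit hC hsub
    exact (hFs (this ▸ heC : e ∈ F)).2 rfl
  obtain ⟨w, hwF', hwD⟩ : ∃ w ∈ F', w ∉ D := by
    by_contra! h
    have := hF'.eq_of_subset_isCircuit hD h
    exact (hFs' (this ▸ heD : e ∈ F')).2 rfl
  have hU := hmin F D hF hD hxF hzD hFD
    (Set.union_subset (fun w hw => (hFs hw).1) Set.subset_union_right)
  have hwC : w ∈ C := (hFs' hwF').1.resolve_left hwD
  have hwF : w ∈ F := (hU.symm ▸ Or.inl hwC : w ∈ F ∪ D).resolve_right hwD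
  have hU' := hmin F F' hF hF' hxF hzF' ⟨w, hwF, hwF'⟩
    (Set.union_subset (fun w hw => (hFs hw).1) (fun w hw => (hFs' hw).1.symm))
  rcases (hU'.symm ▸ Or.inl heC : e ∈ F ∪ F') with h | h
  · exact (hFs h).2 rfl
  · exact (hFs' h).2 rfl

end Matroid

namespace Graph

variable {α β : Type*} {G : Graph α β}

/-! ### Excess and nullity -/

/-- The excess of an edge set `X`: the number of its edges minus the number of their ends. -/
noncomputable def excess (G : Graph α β) (X : Set β) : ℤ :=
  X.ncard - (G.edgeInduce X).vertexSet.ncard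

/-- The nullity of an edge set `X`: the largest excess of a subset of `X`. For finite
`X ⊆ E(G)` this is the nullity of `X` in the bicircular matroid; for infinite `X` the supremum may
be a junk value. -/
noncomputable def nullity (G : Graph α β) (X : Set β) : ℤ :=
  sSup (G.excess '' 𝒫 X)

/-- An edge set is excess-strict if its excess exceeds that of all its proper subsets. For
a finite graph the excess-strict subsets of `E(G)` are the unions of circuits of the bicircular
matroid. -/
def IsExcessStrict (G : Graph α β) (X : Set β) : Prop :=
  ∀ Y, Y ⊂ X → G.excess Y < G.excess X

@[simp]
theorem excess_empty : G.excess ∅ = 0 := by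
  simp [excess, edgeInduce]

theorem excess_le_excess_sdiff_add {X S : Set β} (hX : X.Finite) (hS : S.Finite) :
    G.excess X ≤ G.excess (X \ S) + S.ncard := by
  have h1 := Set.ncard_le_ncard_sdiff_add_ncard X S hS
  have h2 := Set.ncard_le_ncard
    (edgeInduce_vertexSet_mono (G := G) (Set.sdiff_subset (s := X) (t := S)))
    (finite_edgeInduce_vertexSet hX)
  unfold excess
  omega

theorem excess_supermodular {X Y : Set β} (hX : X.Finite) (hY : Y.Finite) :
    G.excess X + G.excess Y ≤ G.excess (X ∪ Y) + G.excess (X ∩ Y) := by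
  have h1 := Set.ncard_union_add_ncard_inter X Y hX hY
  have h2 := Set.ncard_union_add_ncard_inter (G.edgeInduce X).vertexSet
    (G.edgeInduce Y).vertexSet (finite_edgeInduce_vertexSet hX) (finite_edgeInduce_vertexSet hY)
  have h3 : (G.edgeInduce (X ∩ Y)).vertexSet.ncard ≤
      ((G.edgeInduce X).vertexSet ∩ (G.edgeInduce Y).vertexSet).ncard :=
    Set.ncard_le_ncard (Set.subset_inter (edgeInduce_vertexSet_mono Set.inter_subset_left)
      (edgeInduce_vertexSet_mono Set.inter_subset_right))
      ((finite_edgeInduce_vertexSet hX).inter_of_left _)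
  rw [← edgeInduce_vertexSet_union] at h2
  unfold excess
  omega

theorem excess_union_add_ncard_inter {X Y : Set β} (hX : X.Finite) (hY : Y.Finite)
    (hXY : Disjoint X Y) :
    G.excess (X ∪ Y) = G.excess X + G.excess Y +
      ((G.edgeInduce X).vertexSet ∩ (G.edgeInduce Y).vertexSet).ncard := by
  have h1 := Set.ncard_union_eq hXY hX hY
  have h2 := Set.ncard_union_add_ncard_inter (G.edgeInduce X).vertexSet
    (G.edgeInduce Y).vertexSet (finite_edgeInduce_vertexSet hX) (finite_edgeInduce_vertexSet hY)
  rw [← edgeInduce_vertexSet_union] at h2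
  unfold excess
  omega

theorem excess_le_nullity {X Y : Set β} (hX : X.Finite) (hYX : Y ⊆ X) :
    G.excess Y ≤ G.nullity X :=
  le_csSup (hX.finite_subsets.image _).bddAbove ⟨Y, hYX, rfl⟩

theorem exists_excess_eq_nullity {X : Set β} (hX : X.Finite) :
    ∃ Y ⊆ X, G.excess Y = G.nullity X :=
  ((Set.nonempty_of_mem (Set.empty_subset X)).image G.excess).csSup_mem
    (hX.finite_subsets.image _)

theorem nullity_mono {X Y : Set β} (hX : X.Finite) (hYX : Y ⊆ X) :
    G.nullity Y ≤ G.nullity X := by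
  obtain ⟨Z, hZ, h⟩ := exists_excess_eq_nullity (G := G) (hX.subset hYX)
  exact h ▸ excess_le_nullity hX (hZ.trans hYX)

theorem nullity_nonneg {X : Set β} (hX : X.Finite) : 0 ≤ G.nullity X := by
  simpa using excess_le_nullity (G := G) hX (Set.empty_subset X)

theorem nullity_le_nullity_sdiff_add {X S : Set β} (hX : X.Finite) (hS : S.Finite) :
    G.nullity X ≤ G.nullity (X \ S) + S.ncard := by
  obtain ⟨Z, hZ, h⟩ := exists_excess_eq_nullity (G := G) hX
  have h1 := excess_le_excess_sdiff_add (G := G) (hX.subset hZ) hS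
  have h2 := excess_le_nullity (G := G) (hX.subset (Set.sdiff_subset (t := S)))
    (Set.sdiff_subset_sdiff_left hZ)
  omega

theorem nullity_supermodular {X Y : Set β} (hX : X.Finite) (hY : Y.Finite) :
    G.nullity X + G.nullity Y ≤ G.nullity (X ∪ Y) + G.nullity (X ∩ Y) := by
  obtain ⟨A, hA, hA'⟩ := exists_excess_eq_nullity (G := G) hX
  obtain ⟨B, hB, hB'⟩ := exists_excess_eq_nullity (G := G) hY
  have h1 := excess_supermodular (G := G) (hX.subset hA) (hY.subset hB)
  have h2 := excess_le_nullity (G := G) (hX.union hY) (Set.union_subset_union hA hB)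
  have h3 := excess_le_nullity (G := G) (hX.inter_of_left Y) (Set.inter_subset_inter hA hB)
  omega

/-! ### Excess-strict sets -/

theorem IsExcessStrict.excess_pos {X : Set β} (h : G.IsExcessStrict X) (hne : X.Nonempty) :
    0 < G.excess X := by
  simpa using h ∅ hne.empty_ssubset

theorem IsExcessStrict.nullity_eq {X : Set β} (hX : X.Finite) (h : G.IsExcessStrict X) :
    G.nullity X = G.excess X := by
  obtain ⟨Y, hY, hY'⟩ := exists_excess_eq_nullity (G := G) hX
  rcases hY.eq_or_ssubset with rfl | hlt
  · exact hY'.symm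
  · exact absurd (h Y hlt) (by have := excess_le_nullity (G := G) hX subset_rfl; omega)

/-- An element of an excess-strict subset of `X` is not a coloop of `X`. -/
theorem IsExcessStrict.nullity_sdiff_singleton_lt {X C : Set β} {e : β} (hX : X.Finite)
    (hC : G.IsExcessStrict C) (hCX : C ⊆ X) (he : e ∈ C) :
    G.nullity (X \ {e}) < G.nullity X := by
  have hCf := hX.subset hCX
  have hCe : G.nullity (C \ {e}) < G.nullity C := by
    obtain ⟨Y, hY, hY'⟩ := exists_excess_eq_nullity (G := G)
      (hCf.subset (Set.sdiff_subset (t := {e})))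
    rw [← hY', hC.nullity_eq hCf]
    exact hC Y ⟨hY.trans Set.sdiff_subset, fun h => (hY (h he)).2 rfl⟩
  have h := nullity_supermodular (G := G) (hX.subset (Set.sdiff_subset (t := {e}))) hCf
  have h1 : X \ {e} ∪ C = X := by grind
  have h2 : X \ {e} ∩ C = C \ {e} := by grind
  rw [h1, h2] at h
  omega

theorem isExcessStrict_of_forall_nullity_lt {X : Set β} (hX : X.Finite)
    (h : ∀ e ∈ X, G.nullity (X \ {e}) < G.nullity X) : G.IsExcessStrict X := by
  have key : ∀ Y ⊂ X, G.excess Y < G.nullity X := fun Y hY => by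
    obtain ⟨e, heX, heY⟩ := Set.exists_of_ssubset hY
    exact (excess_le_nullity (hX.subset Set.sdiff_subset)
      (Set.subset_sdiff_singleton hY.subset heY)).trans_lt (h e heX)
  obtain ⟨Y, hY, hY'⟩ := exists_excess_eq_nullity (G := G) hX
  rcases hY.eq_or_ssubset with rfl | hlt
  · rwa [← hY'] at key
  · exact absurd (key Y hlt) (by omega)

theorem isExcessStrict_of_forall_mem {X : Set β} (hX : X.Finite)
    (h : ∀ e ∈ X, ∃ C ⊆ X, G.IsExcessStrict C ∧ e ∈ C) : G.IsExcessStrict X :=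
  isExcessStrict_of_forall_nullity_lt hX fun e he => by
    obtain ⟨C, hCX, hC, heC⟩ := h e he
    exact hC.nullity_sdiff_singleton_lt hX hCX heC

theorem exists_isExcessStrict_subset {X : Set β} (hX : X.Finite) :
    ∃ Y ⊆ X, G.IsExcessStrict Y ∧ G.excess Y = G.nullity X := by
  obtain ⟨Z, hZ⟩ := exists_excess_eq_nullity (G := G) hX
  obtain ⟨Y, -, hY⟩ := (hX.finite_subsets.subset
    (fun Y (hY : Y ∈ {Y | Y ⊆ X ∧ G.excess Y = G.nullity X}) => hY.1)).exists_le_minimal hZ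
  refine ⟨Y, hY.prop.1, fun W hW => ?_, hY.prop.2⟩
  have hWX := hW.subset.trans hY.prop.1
  refine lt_of_le_of_ne (hY.prop.2 ▸ excess_le_nullity hX hWX) fun heq => ?_
  exact hW.2 (hY.le_of_le ⟨hWX, heq.trans hY.prop.2⟩ hW.subset)

/-- In an excess-strict set of excess larger than `|S|`, the excess can be lowered by one while
keeping the set excess-strict and the elements of `S`: an edge `e` of a circuit avoiding `S` is
deleted, together with the coloops this creates. No element `a` of `S` becomes a coloop, since
`e` still lies in a circuit avoiding `a`. -/
theorem IsExcessStrict.exists_subset_excess_eq_sub_one {X S : Set β} (hX : X.Finite)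
    (h : G.IsExcessStrict X) (hS : S ⊆ X) (hcard : (S.ncard : ℤ) < G.excess X) :
    ∃ Y ⊆ X, G.IsExcessStrict Y ∧ S ⊆ Y ∧ G.excess Y = G.excess X - 1 := by
  have hν := h.nullity_eq hX
  have hR := nullity_le_nullity_sdiff_add (G := G) hX (hX.subset hS)
  -- `X \ S` still has positive nullity, so it contains a nonempty excess-strict set
  obtain ⟨C, hCR, hC, hCν⟩ := exists_isExcessStrict_subset (G := G)
    (hX.subset (Set.sdiff_subset (t := S)))
  obtain ⟨e, he⟩ : C.Nonempty := by
    rw [Set.nonempty_iff_ne_empty]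
    rintro rfl
    rw [excess_empty] at hCν
    omega
  have hXe := hX.subset (Set.sdiff_subset (t := {e}))
  have h1 := h.nullity_sdiff_singleton_lt hX subset_rfl (hCR he).1
  have h2 := nullity_le_nullity_sdiff_add (G := G) hX (Set.finite_singleton e)
  rw [Set.ncard_singleton] at h2
  obtain ⟨Y, hYX, hY, hYν⟩ := exists_isExcessStrict_subset (G := G) hXe
  refine ⟨Y, hYX.trans Set.sdiff_subset, hY, fun a ha => ?_, by omega⟩
  by_contra haY
  have hXa := hX.subset (Set.sdiff_subset (t := {a}))
  have h3 := hC.nullity_sdiff_singleton_lt hXa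
    (fun f hf => ⟨(hCR hf).1, fun hfa => (hCR hf).2 (hfa ▸ ha)⟩) he
  have h4 := h.nullity_sdiff_singleton_lt hX subset_rfl (hS ha)
  have h5 : G.excess Y ≤ G.nullity ((X \ {a}) \ {e}) :=
    excess_le_nullity (hXa.subset Set.sdiff_subset)
      fun f hf => ⟨⟨(hYX hf).1, fun hfa => haY (hfa ▸ hf)⟩, (hYX hf).2⟩
  omega

theorem IsExcessStrict.exists_subset_excess_eq {X S : Set β} (hX : X.Finite)
    (h : G.IsExcessStrict X) (hS : S ⊆ X) {k : ℕ} (hSk : S.ncard ≤ k) (hk : k ≤ G.excess X) :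
    ∃ Y ⊆ X, G.IsExcessStrict Y ∧ S ⊆ Y ∧ G.excess Y = k := by
  obtain ⟨n, hn⟩ := Int.le.dest hk
  induction n generalizing X with
  | zero => exact ⟨X, subset_rfl, h, hS, by omega⟩
  | succ n ih =>
    obtain ⟨Y, hYX, hY, hSY, hYe⟩ := h.exists_subset_excess_eq_sub_one hX hS (by omega)
    obtain ⟨Z, hZY, hZ⟩ := ih (hX.subset hYX) hY hSY (by omega) (by omega)
    exact ⟨Z, hZY.trans hYX, hZ⟩

/-- For `k ≥ 1` the circuits of the `k`-circular matroid are the excess-strict sets of excess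
`k`. -/
theorem isKCircuit_iff_isExcessStrict (hE : G.edgeSet.Finite) {k : ℕ} (hk : 1 ≤ k) {C : Set β} :
    G.IsKCircuit k C ↔ C ⊆ G.edgeSet ∧ G.IsExcessStrict C ∧ G.excess C = k := by
  constructor
  · intro hC
    have hCe : G.excess C = k := by
      have := hC.prop.2.2
      unfold excess
      omega
    refine ⟨hC.prop.1, fun Y hY => ?_, hCe⟩
    by_contra! hcon
    have hYne : Y.Nonempty := by
      rw [Set.nonempty_iff_ne_empty]
      rintro rfl
      rw [excess_empty] at hcon
      omega
    obtain ⟨D, hDY, hD⟩ := exists_isKCircuit_subset (k := k) hE (hY.subset.trans hC.prop.1) hYne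
      (by unfold excess at *; omega)
    exact hY.2 ((hC.le_of_le hD.prop (hDY.trans hY.subset)).trans hDY)
  · rintro ⟨hCE, hC, hCk⟩
    refine ⟨⟨hCE, ?_, by unfold excess at hCk; omega⟩, fun D hD hDC => ?_⟩
    · rw [Set.nonempty_iff_ne_empty]
      rintro rfl
      rw [excess_empty] at hCk
      omega
    · by_contra hCD
      have h1 := hC D ⟨hDC, hCD⟩
      have h2 := hD.2.2
      unfold excess at *
      omega

/-! ### Separations of the bicircular matroid -/

/-- If every circuit of the bicircular matroid inside `X` lies in `A` or in `B`, then the nullity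
of `X` is at most the sum of the nullities of its two parts. -/
theorem nullity_le_add_of_forall_isKCircuit {X A B : Set β} (hE : G.edgeSet.Finite)
    (hX : X ⊆ G.edgeSet) (h : ∀ C ⊆ X, G.IsKCircuit 1 C → C ⊆ A ∨ C ⊆ B) :
    G.nullity X ≤ G.nullity (X ∩ A) + G.nullity (X ∩ B) := by
  have hXf := hE.subset hX
  induction hn : X.ncard generalizing X with
  | zero =>
    rw [Set.ncard_eq_zero hXf] at hn
    subst hn
    simp [nullity]
  | succ n ih =>
    have hA0 := nullity_nonneg (G := G) (hXf.inter_of_left A)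
    have hB0 := nullity_nonneg (G := G) (hXf.inter_of_left B)
    rcases le_or_gt (G.nullity X) 0 with h0 | h0
    · omega
    obtain ⟨Y, hYX, hY, hYν⟩ := exists_isExcessStrict_subset (G := G) hXf
    obtain ⟨C, hCY, hC, -, hC1⟩ := hY.exists_subset_excess_eq (hXf.subset hYX)
      (Set.empty_subset Y) (k := 1) (by simp) (by omega)
    have hCX := hCY.trans hYX
    obtain ⟨e, he⟩ : C.Nonempty := by
      rw [Set.nonempty_iff_ne_empty]
      rintro rfl
      simp at hC1
    have hXe : (X \ {e}) ⊆ X := Set.sdiff_subset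
    have h1 := nullity_le_nullity_sdiff_add (G := G) hXf (Set.finite_singleton e)
    rw [Set.ncard_singleton] at h1
    have h2 := ih (hXe.trans hX) (fun D hD => h D (hD.trans hXe)) (hXf.subset hXe)
      (by have := Set.ncard_sdiff_singleton_add_one (hCX he) hXf; omega)
    rw [Set.sdiff_inter_right_comm, Set.sdiff_inter_right_comm] at h2
    have hAm := nullity_mono (G := G) (hXf.inter_of_left A) (Set.sdiff_subset (t := {e}))
    have hBm := nullity_mono (G := G) (hXf.inter_of_left B) (Set.sdiff_subset (t := {e}))
    rcases h C hCX ((isKCircuit_iff_isExcessStrict hE le_rfl).2 ⟨hCX.trans hX, hC, hC1⟩)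
      with hCA | hCB
    · have := hC.nullity_sdiff_singleton_lt (hXf.inter_of_left A) (Set.subset_inter hCX hCA) he
      omega
    · have := hC.nullity_sdiff_singleton_lt (hXf.inter_of_left B) (Set.subset_inter hCX hCB) he
      omega

/-- If the edge set of a connected graph is excess-strict, any two edges lie in a common circuit
of the bicircular matroid: otherwise the edges sharing a circuit with `a` and the remaining edges
would have nullities adding up to that of `G`, hence no common vertex. -/
theorem exists_isKCircuit_one_mem_mem (hE : G.edgeSet.Finite) (hG : G.IsConnected)
    (hs : G.IsExcessStrict G.edgeSet) {a b : β} (ha : a ∈ G.edgeSet) (hb : b ∈ G.edgeSet) :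
    ∃ C, G.IsKCircuit 1 C ∧ a ∈ C ∧ b ∈ C := by
  by_contra hcon
  have hcov : ∀ e ∈ G.edgeSet, ∃ C, G.IsKCircuit 1 C ∧ e ∈ C := fun e he => by
    obtain ⟨C, hCE, hC, heC, hC1⟩ := hs.exists_subset_excess_eq hE
      (Set.singleton_subset_iff.2 he) (k := 1) (by simp) (by have := hs.excess_pos ⟨e, he⟩; omega)
    exact ⟨C, (isKCircuit_iff_isExcessStrict hE le_rfl).2 ⟨hCE, hC, hC1⟩, heC rfl⟩
  set A : Set β := {e | ∃ C, G.IsKCircuit 1 C ∧ a ∈ C ∧ e ∈ C} with hA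
  have hAE : A ⊆ G.edgeSet := fun e ⟨C, hC, _, heC⟩ => hC.prop.1 heC
  have hclosed : ∀ C, G.IsKCircuit 1 C → C ⊆ A ∨ C ⊆ G.edgeSet \ A := by
    intro C hC
    by_cases h : ∃ e ∈ C, e ∈ A
    · obtain ⟨e, heC, D, hD, haD, heD⟩ := h
      refine Or.inl fun f hf => ?_
      simp_rw [← kCircularMatroid_isCircuit_iff G hE] at hC hD hA
      rw [hA]
      exact Matroid.exists_isCircuit_mem_mem_trans hE hD haD heD hC heC hf
    · push Not at h
      exact Or.inr fun f hf => ⟨hC.prop.1 hf, h f hf⟩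
  have hstrict : ∀ X ⊆ G.edgeSet, (∀ C, G.IsKCircuit 1 C → (C ∩ X).Nonempty → C ⊆ X) →
      G.IsExcessStrict X := by
    refine fun X hX h => isExcessStrict_of_forall_mem (hE.subset hX) fun e he => ?_
    obtain ⟨C, hC, heC⟩ := hcov e (hX he)
    exact ⟨C, h C hC ⟨e, heC, he⟩, ((isKCircuit_iff_isExcessStrict hE le_rfl).1 hC).2.1, heC⟩
  -- `A` and its complement are unions of circuits, so their nullities are their excesses
  have hAs := hstrict A hAE fun C hC ⟨e, heC, heA⟩ =>
    (hclosed C hC).resolve_right fun h => (h heC).2 heA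
  have hBs := hstrict (G.edgeSet \ A) Set.sdiff_subset fun C hC ⟨e, heC, heA⟩ =>
    (hclosed C hC).resolve_left fun h => heA.2 (h heC)
  have hAf := hE.subset hAE
  have hBf := hE.subset (Set.sdiff_subset (t := A))
  have hν := nullity_le_add_of_forall_isKCircuit hE subset_rfl fun C _ => hclosed C
  rw [Set.inter_eq_right.2 hAE, Set.inter_eq_right.2 Set.sdiff_subset, hs.nullity_eq hE,
    hAs.nullity_eq hAf, hBs.nullity_eq hBf] at hν
  have hsum := excess_union_add_ncard_inter (G := G) hAf hBf Set.disjoint_sdiff_right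
  rw [Set.union_sdiff_cancel hAE] at hsum
  have hdisj : (G.edgeInduce A).vertexSet ∩ (G.edgeInduce (G.edgeSet \ A)).vertexSet = ∅ := by
    rw [← Set.ncard_eq_zero ((finite_edgeInduce_vertexSet hAf).inter_of_left _)]
    omega
  obtain ⟨x, x', hx⟩ := G.exists_isLink_of_mem_edgeSet ha
  obtain ⟨y, y', hy⟩ := G.exists_isLink_of_mem_edgeSet hb
  have haA : a ∈ A := by
    obtain ⟨C, hC, haC⟩ := hcov a ha
    exact ⟨C, hC, haC, haC⟩
  have hyA : y ∈ (G.edgeInduce A).vertexSet := by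
    have hxy := hG.2 x hx.left_mem y hy.left_mem
    clear hy
    induction hxy with
    | refl => exact ⟨a, haA, hx.inc_left⟩
    | tail _ h ih =>
      obtain ⟨f, hf⟩ := h
      by_cases hfA : f ∈ A
      · exact ⟨f, hfA, hf.inc_right⟩
      · exact (hdisj.subset ⟨ih, f, ⟨hf.edge_mem, hfA⟩, hf.inc_left⟩).elim
  exact hdisj.subset ⟨hyA, b, ⟨hb, hcon⟩, hy.inc_left⟩

/-! ### Degrees and components -/

open Classical in
/-- The number of ends of the edge `e` that are equal to `v`, a loop at `v` having two. -/
noncomputable def endCount (G : Graph α β) (e : β) (v : α) : ℕ :=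
  (if G.IsNonloopAt e v then 1 else 0) + 2 * (if G.IsLoopAt e v then 1 else 0)

theorem endCount_eq_zero {e : β} {v : α} (h : ¬ G.Inc e v) : G.endCount e v = 0 := by
  simp [endCount, show ¬ G.IsNonloopAt e v from fun h' => h h'.inc,
    show ¬ G.IsLoopAt e v from fun h' => h h'.inc]

theorem deg_eq_sum_endCount (hE : G.edgeSet.Finite) (v : α) :
    G.deg v = ∑ e ∈ hE.toFinset, G.endCount e v := by
  classical
  have h : ∀ p : β → Prop, (∀ e, p e → e ∈ G.edgeSet) →
      {e | p e}.ncard = ∑ e ∈ hE.toFinset, if p e then 1 else 0 := by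
    intro p hp
    rw [← Finset.card_filter, ← Set.ncard_coe_finset]
    congr 1
    ext e
    simpa using hp e
  simp only [deg, endCount, Finset.sum_add_distrib, ← Finset.mul_sum]
  rw [h _ fun e he => he.edge_mem, h _ fun e he => he.edge_mem]

theorem sum_endCount [DecidableEq α] {e : β} {x y : α} (h : G.IsLink e x y) (W : Finset α) :
    ∑ v ∈ W, G.endCount e v = (if x ∈ W then 1 else 0) + (if y ∈ W then 1 else 0) := by
  have key : ∀ v, G.endCount e v = (if x = v then 1 else 0) + (if y = v then 1 else 0) := by
    intro v
    have h1 : G.IsLoopAt e v ↔ x = v ∧ y = v := by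
      rw [← isLink_self_iff, h.isLink_iff]
      tauto
    have h2 : G.IsNonloopAt e v ↔ (x = v ∨ y = v) ∧ ¬ (x = v ∧ y = v) := by
      rw [isNonloopAt_iff_inc_not_isLoopAt, h1]
      refine and_congr_left fun _ => ⟨fun hv => ?_, ?_⟩
      · exact (hv.eq_or_eq_of_isLink h).imp Eq.symm Eq.symm
      · rintro (rfl | rfl)
        exacts [h.inc_left, h.inc_right]
    simp only [endCount, h1, h2]
    split_ifs <;> simp_all
  simp [key, Finset.sum_add_distrib]

theorem two_le_deg (hE : G.edgeSet.Finite) (hG : G.NoIsolatedVertices) {v : α}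
    (hv : v ∈ G.vertexSet) (hleaf : ¬ G.IsLeaf v) : 2 ≤ G.deg v := by
  have hf1 : {e | G.IsNonloopAt e v}.Finite := hE.subset fun e he => he.edge_mem
  have hf2 : {e | G.IsLoopAt e v}.Finite := hE.subset fun e he => he.edge_mem
  have hloop : ∀ e, G.IsLoopAt e v → 2 ≤ G.deg v := fun e he => by
    have : 0 < {e | G.IsLoopAt e v}.ncard := (Set.ncard_pos hf2).2 ⟨e, he⟩
    unfold deg
    omega
  obtain ⟨e, he⟩ := hG v hv
  rcases he.isLoopAt_or_isNonloopAt with hl | hn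
  · exact hloop e hl
  obtain ⟨f, hf, hfe⟩ : ∃ f, G.Inc f v ∧ f ≠ e := by
    by_contra! h
    exact hleaf ⟨e, Set.eq_singleton_iff_unique_mem.2 ⟨he, h⟩, hn⟩
  rcases hf.isLoopAt_or_isNonloopAt with hl | hn'
  · exact hloop f hl
  have : 1 < {e | G.IsNonloopAt e v}.ncard := (Set.one_lt_ncard hf1).2 ⟨f, hn', e, hn, hfe⟩
  unfold deg
  omega

/-- The component of `G` containing `x`: the vertices joined to `x` by a walk, with all edges of
`G` between them. It has no vertices unless `x` is a vertex of `G`. -/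
def componentOf (G : Graph α β) (x : α) : Graph α β where
  vertexSet := {v | v ∈ G.vertexSet ∧ Relation.ReflTransGen G.Adj x v}
  IsLink e u v := G.IsLink e u v ∧ Relation.ReflTransGen G.Adj x u
  isLink_symm _ _ := ⟨fun _ _ h => ⟨h.1.symm, h.2.tail h.1.adj⟩⟩
  eq_or_eq_of_isLink_of_isLink _ _ _ _ _ h h' := h.1.left_eq_or_eq h'.1
  left_mem_of_isLink _ _ _ h := ⟨h.1.left_mem, h.2⟩

theorem componentOf_le (x : α) : G.componentOf x ≤ G :=
  ⟨fun _ h => h.1, fun _ _ _ h => h.1⟩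

theorem isConnected_componentOf {x : α} (hx : x ∈ G.vertexSet) :
    (G.componentOf x).IsConnected := by
  have key : ∀ v, Relation.ReflTransGen G.Adj x v →
      Relation.ReflTransGen (G.componentOf x).Adj x v := by
    intro v hv
    induction hv with
    | refl => exact .refl
    | tail h hadj ih =>
      obtain ⟨e, he⟩ := hadj
      exact ih.tail ⟨e, he, h⟩
  refine ⟨⟨x, hx, .refl⟩, fun u hu v hv => ?_⟩
  exact (Std.Symm.symm _ _ (key u hu.2)).trans (key v hv.2)

theorem IsConnected.le_componentOf {H : Graph α β} {x : α} (hH : H.IsConnected) (hHG : H ≤ G)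
    (hx : x ∈ H.vertexSet) : H ≤ G.componentOf x := by
  have key : ∀ v ∈ H.vertexSet, Relation.ReflTransGen G.Adj x v := fun v hv =>
    Relation.ReflTransGen.mono (fun _ _ h => Adj.mono hHG h) x v (hH.2 x hx v hv)
  exact ⟨fun v hv => ⟨hHG.vertexSet_mono hv, key v hv⟩,
    fun e u v h => ⟨h.mono hHG, key u h.left_mem⟩⟩

theorem isComponent_componentOf {x : α} (hx : x ∈ G.vertexSet) :
    (G.componentOf x).IsComponent G :=
  ⟨⟨componentOf_le x, isConnected_componentOf hx⟩, fun _ hH hle =>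
    hH.2.le_componentOf hH.1 (hle.vertexSet_mono ⟨hx, .refl⟩)⟩

theorem IsComponent.eq_componentOf {A : Graph α β} {x : α} (hA : A.IsComponent G)
    (hx : x ∈ A.vertexSet) : A = G.componentOf x :=
  le_antisymm (hA.prop.2.le_componentOf hA.prop.1 hx)
    (hA.le_of_ge ⟨componentOf_le x, isConnected_componentOf (hA.prop.1.vertexSet_mono hx)⟩
      (hA.prop.2.le_componentOf hA.prop.1 hx))

theorem deg_componentOf {x v : α} (hv : v ∈ (G.componentOf x).vertexSet) :
    (G.componentOf x).deg v = G.deg v := by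
  have h1 : ∀ e, (G.componentOf x).IsNonloopAt e v ↔ G.IsNonloopAt e v := fun e =>
    ⟨fun h => h.mono (componentOf_le x), fun ⟨w, hw, h⟩ => ⟨w, hw, h, hv.2⟩⟩
  have h2 : ∀ e, (G.componentOf x).IsLoopAt e v ↔ G.IsLoopAt e v := fun e =>
    ⟨fun h => h.mono (componentOf_le x), fun h => ⟨h, hv.2⟩⟩
  simp only [deg, h1, h2]

/-- A finite connected graph with all degrees two is a cycle: a subgraph with all degrees two
uses all edges at each of its vertices, so it contains everything that can be reached from it. -/
theorem IsConnected.isCycleGraph {A : Graph α β} (hE : A.edgeSet.Finite) (hA : A.IsConnected)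
    (hdeg : ∀ v ∈ A.vertexSet, A.deg v = 2) : A.IsCycleGraph := by
  refine ⟨⟨hA.1, hdeg⟩, fun H ⟨⟨x, hx⟩, hHdeg⟩ hHA => ?_⟩
  have hlink : ∀ v ∈ H.vertexSet, ∀ e w, A.IsLink e v w → H.IsLink e v w := by
    intro v hv e w he
    have hf1 : {e | A.IsNonloopAt e v}.Finite := hE.subset fun e he => he.edge_mem
    have hf2 : {e | A.IsLoopAt e v}.Finite := hE.subset fun e he => he.edge_mem
    have hs1 : {e | H.IsNonloopAt e v} ⊆ {e | A.IsNonloopAt e v} := fun e h => h.mono hHA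
    have hs2 : {e | H.IsLoopAt e v} ⊆ {e | A.IsLoopAt e v} := fun e h => h.mono hHA
    have hc1 := Set.ncard_le_ncard hs1 hf1
    have hc2 := Set.ncard_le_ncard hs2 hf2
    have hd := hHdeg v hv
    rw [← hdeg v (hHA.vertexSet_mono hv)] at hd
    unfold deg at hd
    have heq1 := Set.eq_of_subset_of_ncard_le hs1 (by omega) hf1
    have heq2 := Set.eq_of_subset_of_ncard_le hs2 (by omega) hf2
    have heH : e ∈ H.edgeSet := by
      rcases he.inc_left.isLoopAt_or_isNonloopAt with h | h
      · exact (heq2.superset h : H.IsLoopAt e v).edge_mem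
      · exact (heq1.superset h : H.IsNonloopAt e v).edge_mem
    exact (IsSubgraph.isLink_iff hHA heH).2 he
  have hmem : ∀ v ∈ A.vertexSet, v ∈ H.vertexSet := by
    intro v hv
    have hxv := hA.2 x (hHA.vertexSet_mono hx) v hv
    clear hv
    induction hxv with
    | refl => exact hx
    | tail _ h ih =>
      obtain ⟨e, he⟩ := h
      exact (hlink _ ih e _ he).right_mem
  exact ⟨hmem, fun e u v h => hlink u (hmem u h.left_mem) e v h⟩

/-! ### Cacti-graphs -/

theorem NoIsolatedVertices.vertexSet_edgeInduce_edgeSet (hG : G.NoIsolatedVertices) :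
    (G.edgeInduce G.edgeSet).vertexSet = G.vertexSet := by
  ext v
  constructor
  · rintro ⟨e, -, he⟩
    exact he.vertex_mem
  · intro hv
    obtain ⟨e, he⟩ := hG v hv
    exact ⟨e, he.edge_mem, he⟩

/-- If a proper subset `Y` of the edges had at least the excess of the whole edge set, then the
set `W` of vertices missed by `Y` would be at least as large as the set `Z` of edges outside `Y`.
Counting the ends in `W` of the edges of `Z`, whose number is at least `2|W|` and at most `2|Z|`,
shows that all degrees in `W` are two and that all ends of edges of `Z` are in `W`; thus `W`
contains a component that is a cycle. -/
theorem IsCactiGraph.isExcessStrict (hV : G.vertexSet.Finite) (hE : G.edgeSet.Finite)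
    (hG : G.IsCactiGraph) : G.IsExcessStrict G.edgeSet := by
  classical
  intro Y hY
  by_contra! hle
  set VY := (G.edgeInduce Y).vertexSet with hVY
  have hVYV : VY ⊆ G.vertexSet := fun v ⟨e, _, he⟩ => he.vertex_mem
  set W := (hV.sdiff (t := VY)).toFinset with hW
  set Z := (hE.sdiff (t := Y)).toFinset with hZ
  have hmW : ∀ v, v ∈ W ↔ v ∈ G.vertexSet ∧ v ∉ VY := by simp [hW]
  have hmZ : ∀ e, e ∈ Z ↔ e ∈ G.edgeSet ∧ e ∉ Y := by simp [hZ]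
  have hZW : Z.card ≤ W.card := by
    have h1 := Set.ncard_sdiff_add_ncard_of_subset (s := Y) (t := G.edgeSet) hY.subset hE
    have h2 := Set.ncard_sdiff_add_ncard_of_subset hVYV hV
    rw [hZ, hW, ← Set.ncard_eq_toFinset_card _ hE.sdiff, ← Set.ncard_eq_toFinset_card _ hV.sdiff]
    unfold excess at hle
    rw [hG.no_isolated.vertexSet_edgeInduce_edgeSet, ← hVY] at hle
    omega
  have hdegZ : ∀ v ∈ W, G.deg v = ∑ e ∈ Z, G.endCount e v := by
    intro v hv
    rw [deg_eq_sum_endCount hE]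
    refine (Finset.sum_subset (fun e he => by simpa using ((hmZ e).1 he).1) ?_).symm
    intro e he heZ
    refine endCount_eq_zero fun hinc => ((hmW v).1 hv).2 ⟨e, ?_, hinc⟩
    by_contra heY
    exact heZ ((hmZ e).2 ⟨hinc.edge_mem, heY⟩)
  have hdeg2 : ∀ v ∈ W, 2 ≤ G.deg v := fun v hv =>
    two_le_deg hE hG.no_isolated ((hmW v).1 hv).1 (hG.no_leaf v ((hmW v).1 hv).1)
  have hends : ∀ e ∈ Z, ∑ v ∈ W, G.endCount e v ≤ 2 := by
    intro e he
    obtain ⟨x, y, hxy⟩ := G.exists_isLink_of_mem_edgeSet ((hmZ e).1 he).1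
    rw [sum_endCount hxy]
    split_ifs <;> omega
  have hcount : ∑ v ∈ W, G.deg v = ∑ e ∈ Z, ∑ v ∈ W, G.endCount e v := by
    rw [Finset.sum_comm]
    exact Finset.sum_congr rfl hdegZ
  have hlo := Finset.sum_le_sum hdeg2
  have hhi := Finset.sum_le_sum hends
  have hlo' := Finset.sum_const (s := W) (2 : ℕ)
  have hhi' := Finset.sum_const (s := Z) (2 : ℕ)
  rw [smul_eq_mul] at hlo' hhi'
  -- `2|W| ≤ ∑ deg = ∑ ends ≤ 2|Z| ≤ 2|W|`, so all these sums agree term by term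
  have hdegeq := (Finset.sum_eq_sum_iff_of_le hdeg2).1 (by omega)
  have hendeq := (Finset.sum_eq_sum_iff_of_le hends).1 (by omega)
  have hclosed : ∀ e ∈ Z, ∀ x y, G.IsLink e x y → x ∈ W := by
    intro e he x y hxy
    have h := hendeq e he
    rw [sum_endCount hxy] at h
    by_contra hx
    rw [if_neg hx] at h
    split_ifs at h <;> omega
  obtain ⟨e, heE, heY⟩ := Set.exists_of_ssubset hY
  obtain ⟨x, y, hxy⟩ := G.exists_isLink_of_mem_edgeSet heE
  have hxW := hclosed e ((hmZ e).2 ⟨heE, heY⟩) x y hxy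
  have hreach : ∀ v, Relation.ReflTransGen G.Adj x v → v ∈ W := by
    intro v hv
    induction hv with
    | refl => exact hxW
    | tail _ h ih =>
      obtain ⟨f, hf⟩ := h
      exact hclosed f ((hmZ f).2 ⟨hf.edge_mem,
        fun hfY => ((hmW _).1 ih).2 ⟨f, hfY, hf.inc_left⟩⟩) _ _ hf.symm
  have hxV := hxy.left_mem
  refine hG.no_cycle_component _ (isComponent_componentOf hxV) ?_
  refine (isConnected_componentOf hxV).isCycleGraph
    (hE.subset (componentOf_le x).edgeSet_mono) fun v hv => ?_
  rw [deg_componentOf hv]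
  exact (hdegeq v (hreach v hv.2)).symm

theorem excess_nonpos_of_deg_le_two (hE : G.edgeSet.Finite) {Y : Set β} (hY : Y ⊆ G.edgeSet)
    (hdeg : ∀ v ∈ (G.edgeInduce Y).vertexSet, G.deg v ≤ 2) : G.excess Y ≤ 0 := by
  classical
  have hYf := hE.subset hY
  have hWf := finite_edgeInduce_vertexSet (G := G) hYf
  have h1 : ∑ e ∈ hYf.toFinset, ∑ v ∈ hWf.toFinset, G.endCount e v = hYf.toFinset.card * 2 := by
    refine Finset.sum_const_nat fun e he => ?_
    have heY : e ∈ Y := by simpa using he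
    obtain ⟨x, y, hxy⟩ := G.exists_isLink_of_mem_edgeSet (hY heY)
    rw [sum_endCount hxy, if_pos (hWf.mem_toFinset.2 ⟨e, heY, hxy.inc_left⟩),
      if_pos (hWf.mem_toFinset.2 ⟨e, heY, hxy.inc_right⟩)]
  have h2 : ∑ v ∈ hWf.toFinset, ∑ e ∈ hYf.toFinset, G.endCount e v ≤
      hWf.toFinset.card * 2 := by
    refine Finset.sum_le_card_nsmul _ _ _ fun v hv => ?_
    refine le_trans ?_ (hdeg v (hWf.mem_toFinset.1 hv))
    rw [deg_eq_sum_endCount hE]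
    exact Finset.sum_le_sum_of_subset (Set.Finite.toFinset_subset_toFinset.2 hY)
  rw [Finset.sum_comm, h1] at h2
  rw [excess, Set.ncard_eq_toFinset_card Y hYf, Set.ncard_eq_toFinset_card _ hWf]
  omega

/-- Every nonempty part of an excess-strict set that shares no vertex with the rest of the set has
positive excess, since otherwise it could be deleted without lowering the excess. -/
theorem IsExcessStrict.excess_inter_pos {C A : Set β} (hCf : C.Finite) (hC : G.IsExcessStrict C)
    (hA : (C ∩ A).Nonempty)
    (hdisj : Disjoint (G.edgeInduce (C ∩ A)).vertexSet (G.edgeInduce (C \ A)).vertexSet) :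
    0 < G.excess (C ∩ A) := by
  have h := excess_union_add_ncard_inter (G := G) (hCf.inter_of_left A)
    (hCf.subset (Set.sdiff_subset (t := A)))
    (Set.disjoint_sdiff_right.mono_left Set.inter_subset_right)
  rw [Set.inter_union_sdiff, hdisj.inter_eq, Set.ncard_empty] at h
  obtain ⟨e, heC, heA⟩ := hA
  have := hC (C \ A) ⟨Set.sdiff_subset, fun h => (h heC).2 heA⟩
  omega

/-- If every edge lies in an excess-strict set, then there are no leaves and no components that
are cycles: the edge at a leaf, or the edges of such a component, could be deleted from an
excess-strict set without lowering its excess. -/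
theorem isCactiGraph_of_forall_mem_isExcessStrict (hE : G.edgeSet.Finite)
    (hG : G.NoIsolatedVertices)
    (h : ∀ e ∈ G.edgeSet, ∃ C ⊆ G.edgeSet, G.IsExcessStrict C ∧ e ∈ C) : G.IsCactiGraph := by
  refine ⟨hG, fun v hv ⟨e, he, hev⟩ => ?_, fun A hA hAc => ?_⟩
  · obtain ⟨C, hCE, hC, heC⟩ := h e hev.edge_mem
    have hCf := hE.subset hCE
    have hlt := hC (C \ {e}) (Set.sdiff_singleton_ssubset.2 heC)
    have hc := Set.ncard_sdiff_singleton_add_one heC hCf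
    have hVlt : (G.edgeInduce (C \ {e})).vertexSet.ncard < (G.edgeInduce C).vertexSet.ncard := by
      refine Set.ncard_lt_ncard ⟨edgeInduce_vertexSet_mono Set.sdiff_subset, fun hsub => ?_⟩
        (finite_edgeInduce_vertexSet hCf)
      obtain ⟨f, hf, hfv⟩ := hsub ⟨e, heC, hev.inc⟩
      exact hf.2 (he.subset hfv)
    unfold excess at hlt
    omega
  · obtain ⟨x, hx⟩ := hA.prop.2.1
    obtain rfl := hA.eq_componentOf hx
    obtain ⟨e, he⟩ := hG x hx.1
    obtain ⟨y, hxy⟩ := id he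
    obtain ⟨C, hCE, hC, heC⟩ := h e he.edge_mem
    have hmem : ∀ f ∈ (G.componentOf x).edgeSet, ∀ v, G.Inc f v →
        v ∈ (G.componentOf x).vertexSet := fun f hf v hfv =>
      (((componentOf_le x).inc_congr hf).2 hfv).vertex_mem
    have hpos := hC.excess_inter_pos (hE.subset hCE) (A := (G.componentOf x).edgeSet)
      ⟨e, heC, x, y, hxy, .refl⟩ <| by
        rw [Set.disjoint_left]
        rintro v ⟨f, hf, hfv⟩ ⟨g, hg, w, hgv⟩
        exact hg.2 ⟨v, w, hgv, (hmem f hf.2 v hfv).2⟩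
    have hnonpos := excess_nonpos_of_deg_le_two hE (Set.inter_subset_left.trans hCE) <| by
      rintro v ⟨f, hf, hfv⟩
      have hv := hmem f hf.2 v hfv
      rw [← deg_componentOf hv, hAc.prop.2 v hv]
    omega

/-- A circuit of the bicircular matroid cannot meet two components of the graph, since one of its
two vertex-disjoint parts would have positive excess. -/
theorem isConnected_of_forall_isKCircuit_one (hE : G.edgeSet.Finite) (hG : G.NoIsolatedVertices)
    (hne : G.vertexSet.Nonempty)
    (h : ∀ a ∈ G.edgeSet, ∀ b ∈ G.edgeSet, ∃ C, G.IsKCircuit 1 C ∧ a ∈ C ∧ b ∈ C) :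
    G.IsConnected := by
  refine ⟨hne, fun x hx y hy => ?_⟩
  by_contra hxy
  obtain ⟨a, ha⟩ := hG x hx
  obtain ⟨b, hb⟩ := hG y hy
  obtain ⟨C, hC, haC, hbC⟩ := h a ha.edge_mem b hb.edge_mem
  obtain ⟨hCE, hCs, hC1⟩ := (isKCircuit_iff_isExcessStrict hE le_rfl).1 hC
  set A : Set β := (G.componentOf x).edgeSet with hA
  have hbA : b ∉ A := fun h =>
    hxy (((componentOf_le x).inc_congr h).2 hb).vertex_mem.2
  have haA : a ∈ A := by
    obtain ⟨z, hz⟩ := ha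
    exact ⟨x, z, hz, .refl⟩
  have hpos := hCs.excess_inter_pos (hE.subset hCE) (A := A) ⟨a, haC, haA⟩ <| by
    rw [Set.disjoint_left]
    rintro v ⟨f, hf, hfv⟩ ⟨g, hg, w, hgv⟩
    exact hg.2 ⟨v, w, hgv, (((componentOf_le x).inc_congr hf.2).2 hfv).vertex_mem.2⟩
  have hlt := hCs (C ∩ A) ⟨Set.inter_subset_left, fun h => hbA (h hbC).2⟩
  omega

/-! ### Connectedness of the `k`-circular matroids -/

theorem ncard_lt_of_isKCircuit {k : ℕ} {C : Set β} (hE : G.edgeSet.Finite)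
    (hC : G.IsKCircuit k C) : k < C.ncard := by
  obtain ⟨e, he⟩ := hC.prop.2.1
  obtain ⟨x, y, hxy⟩ := G.exists_isLink_of_mem_edgeSet (hC.prop.1 he)
  have hpos : 0 < (G.edgeInduce C).vertexSet.ncard :=
    (Set.ncard_pos (finite_edgeInduce_vertexSet (hE.subset hC.prop.1))).2
      ⟨x, e, he, hxy.inc_left⟩
  have := hC.prop.2.2
  omega

theorem exists_isKCircuit_of_isNontrivial {k : ℕ} (hE : G.edgeSet.Finite)
    (h : (G.kCircularMatroid hE k).IsNontrivial) : ∃ C, G.IsKCircuit k C := by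
  by_contra! hno
  refine h.1 (Matroid.ground_indep_iff_isBase.1 ?_)
  exact (⟨subset_rfl, fun C hC => (hno C hC).elim⟩ : G.KIndep k G.edgeSet)

theorem isNontrivial_kCircularMatroid {k : ℕ} (hk : 1 ≤ k) (hE : G.edgeSet.Finite) {C : Set β}
    (hC : G.IsKCircuit k C) : (G.kCircularMatroid hE k).IsNontrivial := by
  have hC' := (kCircularMatroid_isCircuit_iff G hE k C).2 hC
  refine ⟨fun hB => hC'.not_indep (hB.indep.subset hC'.subset_ground), fun hB => ?_⟩
  obtain ⟨e, he⟩ := hC.prop.2.1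
  have heI : (G.kCircularMatroid hE k).Indep {e} := by
    refine (⟨Set.singleton_subset_iff.2 (hC.prop.1 he), fun D hD hDe => ?_⟩ : G.KIndep k {e})
    have h1 := ncard_lt_of_isKCircuit hE hD
    have h2 := Set.ncard_le_ncard hDe
    rw [Set.ncard_singleton] at h2
    omega
  rw [Matroid.dual_isBase_iff, Set.sdiff_self] at hB
  exact (hB.eq_of_subset_indep heI (Set.empty_subset _)).symm.subset rfl

theorem isConnected_kCircularMatroid_of_forall {k : ℕ} (hk : 1 ≤ k) (hE : G.edgeSet.Finite)
    {C : Set β} (hC : G.IsKCircuit k C)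
    (h : ∀ a ∈ G.edgeSet, ∀ b ∈ G.edgeSet, ∃ D, G.IsKCircuit k D ∧ a ∈ D ∧ b ∈ D) :
    (G.kCircularMatroid hE k).IsConnected := by
  refine ⟨?_, fun a ha b hb => ?_⟩
  · rw [kCircularMatroid_ground, ← hE.cast_ncard_eq]
    have h1 := ncard_lt_of_isKCircuit hE hC
    have h2 := Set.ncard_le_ncard hC.prop.1 hE
    exact_mod_cast (by omega : 2 ≤ G.edgeSet.ncard)
  · simp_rw [kCircularMatroid_isCircuit_iff]
    exact h a ha b hb

theorem isNontrivial_and_isCactiGraph_of_isConnected {k : ℕ} (hk : 1 ≤ k)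
    (hE : G.edgeSet.Finite) (hG : G.NoIsolatedVertices)
    (h : (G.kCircularMatroid hE k).IsConnected) :
    (G.kCircularMatroid hE k).IsNontrivial ∧ G.IsCactiGraph := by
  obtain ⟨h2, hconn⟩ := h
  simp_rw [kCircularMatroid_isCircuit_iff] at hconn
  obtain ⟨e, he⟩ : (G.kCircularMatroid hE k).E.Nonempty := by
    rw [Set.nonempty_iff_ne_empty]
    intro h0
    simp [h0] at h2
  obtain ⟨C, hC, -⟩ := hconn e he e he
  refine ⟨isNontrivial_kCircularMatroid hk hE hC,
    isCactiGraph_of_forall_mem_isExcessStrict hE hG fun f hf => ?_⟩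
  obtain ⟨D, hD, hfD, -⟩ := hconn f hf f hf
  have hD' := (isKCircuit_iff_isExcessStrict hE hk).1 hD
  exact ⟨D, hD'.1, hD'.2.1, hfD⟩

end Graph

theorem mainTheorem3 {α β : Type*} (G : Graph α β)
    (hV : G.vertexSet.Finite) (hE : G.edgeSet.Finite) (hG : G.NoIsolatedVertices) :
    (∀ k : ℕ, 2 ≤ k →
      (((G.kCircularMatroid hE k).IsNontrivial ∧ G.IsCactiGraph) ↔
        (G.kCircularMatroid hE k).IsConnected)) ∧
    (((G.kCircularMatroid hE 1).IsNontrivial ∧ G.IsCactiGraph ∧ G.IsConnected) ↔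
      (G.kCircularMatroid hE 1).IsConnected) := by
  refine ⟨fun k hk => ⟨fun ⟨hN, hcacti⟩ => ?_, fun h =>
    Graph.isNontrivial_and_isCactiGraph_of_isConnected (by omega) hE hG h⟩,
    fun ⟨hN, hcacti, hconn⟩ => ?_, fun h => ?_⟩
  · have hs := hcacti.isExcessStrict hV hE
    have hk1 : 1 ≤ k := by omega
    obtain ⟨C, hC⟩ := Graph.exists_isKCircuit_of_isNontrivial hE hN
    refine Graph.isConnected_kCircularMatroid_of_forall hk1 hE hC fun a ha b hb => ?_
    have hC' := (Graph.isKCircuit_iff_isExcessStrict hE hk1).1 hC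
    have hkE : (k : ℤ) ≤ G.excess G.edgeSet := by
      rw [← hC'.2.2, ← hs.nullity_eq hE]
      exact Graph.excess_le_nullity hE hC'.1
    obtain ⟨D, hDE, hD, habD, hDk⟩ := hs.exists_subset_excess_eq hE (S := {a, b})
      (Set.pair_subset ha hb) ((Set.ncard_insert_le a {b}).trans (by simpa using hk)) hkE
    exact ⟨D, (Graph.isKCircuit_iff_isExcessStrict hE hk1).2 ⟨hDE, hD, hDk⟩,
      habD (Set.mem_insert a _), habD (Set.mem_insert_of_mem a rfl)⟩
  · obtain ⟨C, hC⟩ := Graph.exists_isKCircuit_of_isNontrivial hE hN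
    exact Graph.isConnected_kCircularMatroid_of_forall le_rfl hE hC fun a ha b hb =>
      Graph.exists_isKCircuit_one_mem_mem hE hconn (hcacti.isExcessStrict hV hE) ha hb
  · obtain ⟨hN, hcacti⟩ := Graph.isNontrivial_and_isCactiGraph_of_isConnected le_rfl hE hG h
    refine ⟨hN, hcacti, Graph.isConnected_of_forall_isKCircuit_one hE hG ?_ ?_⟩
    · obtain ⟨C, hC⟩ := Graph.exists_isKCircuit_of_isNontrivial hE hN
      obtain ⟨e, he⟩ := hC.prop.2.1
      obtain ⟨x, y, hxy⟩ := G.exists_isLink_of_mem_edgeSet (hC.prop.1 he)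
      exact ⟨x, hxy.left_mem⟩
    · have hconn := h.2
      simp_rw [Graph.kCircularMatroid_isCircuit_iff] at hconn
      exact hconn
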